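/- Let $S=\{a_n\}_{n\ge 1}$ be a sequence of complex numbers with $0<|a_1|\le|a_2|\le\cdots\to\infty$ and finite exponent of convergence $\alpha=\limsup_{n\to\infty}\frac{\ln n}{\ln|a_n|}$. Let $\Psi\in[-\pi,\pi)$ be such that no $a_n$ lies on the ray $R_\Psi=\{te^{i\Psi}:t\ge 0\}$, and let $z\mapsto z^{-s}=e^{-s\log z}$ be defined on $\mathbb C\setminus R_\Psi$ by any branch of the logarithm with branch cut $R_\Psi$. Put $\zeta_S(s)=\sum_{n\ge1}a_n^{-s}$. Let $k\ge 1$ be the integer with $k-1\le\alpha<k$ and let $$H(z)=\prod_{n=1}^\infty E\Big(\frac{z}{a_n},k-1\Big),\qquad E(u,k-1)=(1-u)\exp\Big[\sum_{j=1}^{k-1}\frac{u^j}{j}\Big].$$ Let $\delta>0$ and let $\gamma:\mathbb R\to\mathbb C$ be a continuous curve, continuously differentiable off a set of break points that is finite in every bounded interval, such that $|\gamma(t)|\to\infty$ as $t\to\pm\infty$ and $\int_\gamma|z|^{-1-\varepsilon}\,|dz|<\infty$ for every $\varepsilon>0$. Assume that $\gamma$ avoids the ray $R_\Psi$ and all the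 discs $\{z:|z-a_n|\le\delta|a_n|\}$, $n\ge1$, and that it encloses every $a_n$ once in the counterclockwise direction, with the convention that the points of the cut $R_\Psi$ are outside, that is, $$\frac1{2\pi i}\int_\gamma\Big(\frac1{z-a_n}-\frac1z\Big)dz=1\qquad(n\ge1).$$ (This integral is the winding number around the origin of the curve $(\gamma-a_n)/\gamma$, which is closed by its common limit $1$ at both ends. For a simple curve $\gamma$ with $R_\Psi$ on its right, the condition says that all $a_n$ lie on its left.) Then the product defining $H(z)$ converges for every $z\in\mathbb C$, and for every $s\in\mathbb C$ with $\operatorname{Re}s>\alpha$ the series $\zeta_S(s)$ and the integral below converge absolutely, and $$\zeta_S(s)=\frac1{2\pi i}\int_\gamma z^{-s}\,\frac{d}{dz}\ln H(z)\,dz,\qquad\text{where } \frac{d}{dz}\ln H=\frac{H'}{H}.$$ -/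

import Mathlib

open Filter Topology MeasureTheory

noncomputable section

namespace ZetaContour

/-- The exponent of convergence `limsup_{n → ∞} ln n / ln |a_n|` of a sequence `a_1, a_2, …`, as an
extended real number. The term `a_n` of the sequence (with `n ≥ 1`) is `a (n - 1)`. -/
def convergenceExponent (a : ℕ → ℂ) : EReal :=
  limsup (fun n : ℕ => ((Real.log ((n : ℝ) + 1) / Real.log ‖a n‖ : ℝ) : EReal)) atTop

/-- The closed ray `R_Ψ = {t e^(iΨ) : t ≥ 0}`. -/
def cutRay (Ψ : ℝ) : Set ℂ :=
  {z | ∃ t : ℝ, 0 ≤ t ∧ z = (t : ℂ) * Complex.exp (Complex.I * (Ψ : ℂ))}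

/-- The branches of the logarithm with branch cut `R_Ψ`: off the ray, the `m`-th one has its
imaginary part in `(Ψ - 2π + 2πm, Ψ + 2πm)`. -/
def logBranch (Ψ : ℝ) (m : ℤ) (z : ℂ) : ℂ :=
  Complex.log (z * Complex.exp (-(Complex.I * ((Ψ - Real.pi : ℝ) : ℂ))))
    + Complex.I * ((Ψ - Real.pi + 2 * Real.pi * m : ℝ) : ℂ)

/-- The power `z ^ (-s)` with branch cut `R_Ψ`. -/
def powNeg (Ψ : ℝ) (m : ℤ) (s z : ℂ) : ℂ :=
  Complex.exp (-s * logBranch Ψ m z)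

/-- The zeta function `ζ_S(s) = ∑ a_n ^ (-s)` of a sequence. -/
def zetaSeq (Ψ : ℝ) (m : ℤ) (a : ℕ → ℂ) (s : ℂ) : ℂ :=
  ∑' n, powNeg Ψ m s (a n)

/-- The Weierstrass elementary factor `E(u, q) = (1 - u) exp (u + u² / 2 + ⋯ + u^q / q)`. -/
def elementaryFactor (u : ℂ) (q : ℕ) : ℂ :=
  (1 - u) * Complex.exp (∑ j ∈ Finset.Icc 1 q, 1 / (j : ℂ) * u ^ j)

/-- The Hadamard characteristic function `H(z) = ∏ E(z / a_n, q)`. -/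
def hadamardFunction (a : ℕ → ℂ) (q : ℕ) (z : ℂ) : ℂ :=
  ∏' n, elementaryFactor (z / a n) q

/-- The set `B_δ`, the union of the closed discs `|z - a_n| ≤ δ |a_n|`. -/
def discUnion (a : ℕ → ℂ) (δ : ℝ) : Set ℂ :=
  ⋃ n, {z | ‖a n - z‖ ≤ δ * ‖a n‖}

/-- A contour from `∞` to `∞`: a continuous, piecewise continuously differentiable curve with
locally finitely many break points, both of whose ends go to infinity, and along which
`|z| ^ (-1 - ε)` is absolutely integrable with respect to arc length for every `ε > 0`. It need
not be simple. -/
structure IsContour (γ : ℝ → ℂ) : Prop where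
  continuous : Continuous γ
  piecewise : ∃ P : Set ℝ, (∀ R : ℝ, (P ∩ Set.Icc (-R) R).Finite) ∧ ContDiffOn ℝ 1 γ Pᶜ
  tendsto_atTop : Tendsto (fun t => ‖γ t‖) atTop atTop
  tendsto_atBot : Tendsto (fun t => ‖γ t‖) atBot atTop
  integrable : ∀ ε : ℝ, 0 < ε → Integrable (fun t => ‖γ t‖ ^ (-1 - ε) * ‖deriv γ t‖)

/-- The winding number around `w` of a contour from `∞` to `∞` that avoids `0` and `w`, in the
normalization in which the winding number around `0` is zero: the ordinary winding number around
the origin of the curve `(γ - w) / γ`, which closes up at `∞` with the value `1`. For a simple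
contour with `0` on its right it is `1` at the points on its left and `0` at those on its right. -/
def contourIndex (γ : ℝ → ℂ) (w : ℂ) : ℂ :=
  (2 * (Real.pi : ℂ) * Complex.I)⁻¹ * ∫ t, (1 / (γ t - w) - 1 / γ t) * deriv γ t

end ZetaContour

end

/-!
The proof rests on the expansion `H' / H (z) = ∑ (z / a_n) ^ q / (z - a_n)` with `q = k - 1`
(`logDeriv_hadamardFunction`), which is integrated term by term against `z ^ (-s)`.

*Each term.* Let `b` be one of the `a_n` and `g (z) = z ^ (-s) (z / b) ^ q`, so that
`g (b) = b ^ (-s)`. Then `g (z) dz / (z - b)` is the sum of `g (b) (1 / (z - b) - 1 / z) dz`, whose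
integral is `2 π i g (b)` by the hypothesis on the index, and of a differential that is holomorphic
off the cut, the singularity at `b` being removable. In the coordinate `w = log z` the latter lives
on a convex strip, where it has a primitive, and it decays like `exp (-ε Re w)` because `re s > q`.
Hence the primitive has a limit as `Re w → ∞`, the same along both ends of the contour, and the
integral of this differential vanishes (`exists_primitive_norm_sub_le`,
`IsContour.integral_comp_logBranch_eq_zero`, `IsContour.integral_powNeg_mul`). No deformation of
the contour is needed, so it does not matter whether it is simple.

*The sum.* Off the discs, `|z - a_n|` is bounded below by multiples of both `|z|` and `|a_n|`, hence
by a multiple of `|z| ^ θ |a_n| ^ (1 - θ)` for each `θ ∈ [0, 1]`. For `α < β < min (re s) k` the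
choice `θ = k - β` bounds the `n`-th term by a multiple of
`|a_n| ^ (-β) |z| ^ (-1 - (re s - β))` (`norm_powNeg_mul_le`), summable in `n` and integrable along
the contour, and dominated convergence applies.
-/

namespace ZetaContour

/-! ### Branches of the logarithm and of the power -/

lemma ne_zero_of_notMem_cutRay {Ψ : ℝ} {z : ℂ} (hz : z ∉ cutRay Ψ) : z ≠ 0 := by
  rintro rfl
  exact hz ⟨0, le_rfl, by simp⟩

lemma mul_exp_mem_slitPlane {Ψ : ℝ} {z : ℂ} (hz : z ∉ cutRay Ψ) :
    z * Complex.exp (-(Complex.I * ((Ψ - Real.pi : ℝ) : ℂ))) ∈ Complex.slitPlane := by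
  rw [Complex.mem_slitPlane_iff_not_le_zero]
  intro hle
  apply hz
  obtain ⟨hre, him⟩ := Complex.le_def.1 hle
  set u := z * Complex.exp (-(Complex.I * ((Ψ - Real.pi : ℝ) : ℂ))) with hu
  have hu' : u = (u.re : ℂ) := Complex.ext (by simp) (by simpa using him)
  have hz' : z = u * Complex.exp (Complex.I * ((Ψ - Real.pi : ℝ) : ℂ)) := by
    rw [hu, mul_assoc, ← Complex.exp_add]
    simp
  refine ⟨-u.re, by simpa using hre, ?_⟩
  rw [hz', hu']
  push_cast
  rw [mul_sub, Complex.exp_sub, mul_comm Complex.I (Real.pi : ℂ), Complex.exp_pi_mul_I]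
  simp only [Complex.ofReal_re]
  ring

lemma exp_logBranch {Ψ : ℝ} (m : ℤ) {z : ℂ} (hz : z ∉ cutRay Ψ) :
    Complex.exp (logBranch Ψ m z) = z := by
  have h0 := Complex.slitPlane_ne_zero (mul_exp_mem_slitPlane hz)
  rw [logBranch, Complex.exp_add, Complex.exp_log h0, mul_assoc, ← Complex.exp_add]
  have : -(Complex.I * ((Ψ - Real.pi : ℝ) : ℂ))
      + Complex.I * ((Ψ - Real.pi + 2 * Real.pi * m : ℝ) : ℂ)
      = (m : ℂ) * (2 * Real.pi * Complex.I) := by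
    push_cast
    ring
  rw [this, Complex.exp_int_mul_two_pi_mul_I, mul_one]

lemma hasDerivAt_logBranch {Ψ : ℝ} (m : ℤ) {z : ℂ} (hz : z ∉ cutRay Ψ) :
    HasDerivAt (logBranch Ψ m) z⁻¹ z := by
  have hs := mul_exp_mem_slitPlane hz
  have h := ((((hasDerivAt_id z).mul_const
    (Complex.exp (-(Complex.I * ((Ψ - Real.pi : ℝ) : ℂ))))).clog hs).add_const
    (Complex.I * ((Ψ - Real.pi + 2 * Real.pi * m : ℝ) : ℂ)))
  refine h.congr_deriv ?_
  have := ne_zero_of_notMem_cutRay hz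
  have := Complex.exp_ne_zero (-(Complex.I * ((Ψ - Real.pi : ℝ) : ℂ)))
  simp only [id]
  field_simp

lemma abs_im_logBranch_sub_lt {Ψ : ℝ} (m : ℤ) {z : ℂ} (hz : z ∉ cutRay Ψ) :
    |(logBranch Ψ m z).im - (Ψ - Real.pi + 2 * Real.pi * m)| < Real.pi := by
  have hs := mul_exp_mem_slitPlane hz
  have him : (logBranch Ψ m z).im = Complex.arg (z * Complex.exp
      (-(Complex.I * ((Ψ - Real.pi : ℝ) : ℂ)))) + (Ψ - Real.pi + 2 * Real.pi * m) := by
    rw [logBranch, Complex.add_im, Complex.log_im, Complex.I_mul_im, Complex.ofReal_re]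
  rw [him, add_sub_cancel_right, abs_lt]
  exact ⟨Complex.neg_pi_lt_arg _, lt_of_le_of_ne (Complex.arg_le_pi _)
    (Complex.slitPlane_arg_ne_pi hs)⟩

lemma exp_re_logBranch {Ψ : ℝ} (m : ℤ) {z : ℂ} (hz : z ∉ cutRay Ψ) :
    Real.exp (logBranch Ψ m z).re = ‖z‖ := by
  rw [← Complex.norm_exp, exp_logBranch m hz]

lemma re_logBranch {Ψ : ℝ} (m : ℤ) {z : ℂ} (hz : z ∉ cutRay Ψ) :
    (logBranch Ψ m z).re = Real.log ‖z‖ := by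
  rw [← exp_re_logBranch m hz, Real.log_exp]

/-- On the strip of height `2π` centred at height `c`, the exponential `exp (-s w)` is comparable
to `exp (- (re s) (re w))`. -/
lemma norm_exp_neg_mul_le {c : ℝ} (s : ℂ) {w : ℂ} (hw : |w.im - c| < Real.pi) :
    ‖Complex.exp (-s * w)‖
      ≤ Real.exp (|s.im| * (Real.pi + |c|)) * Real.exp (-s.re * w.re) := by
  rw [Complex.norm_exp, ← Real.exp_add, Real.exp_le_exp]
  have h1 : |w.im| ≤ Real.pi + |c| := by
    have := abs_add_le (w.im - c) c
    rw [sub_add_cancel] at this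
    linarith
  have h2 : s.im * w.im ≤ |s.im| * (Real.pi + |c|) := by
    refine (le_abs_self _).trans ?_
    rw [abs_mul]
    gcongr
  simp only [Complex.mul_re, Complex.neg_re, Complex.neg_im]
  linarith

/-- The constant in the bound `‖z ^ (-s)‖ ≤ C ‖z‖ ^ (-re s)`. -/
noncomputable def powBound (Ψ : ℝ) (m : ℤ) (s : ℂ) : ℝ :=
  Real.exp (|s.im| * (Real.pi + |Ψ - Real.pi + 2 * Real.pi * m|))

lemma norm_powNeg_le {Ψ : ℝ} (m : ℤ) (s : ℂ) {z : ℂ} (hz : z ∉ cutRay Ψ) :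
    ‖powNeg Ψ m s z‖ ≤ powBound Ψ m s * ‖z‖ ^ (-s.re) := by
  refine (norm_exp_neg_mul_le s (abs_im_logBranch_sub_lt m hz)).trans_eq ?_
  rw [powBound, re_logBranch m hz,
    Real.rpow_def_of_pos (norm_pos_iff.2 (ne_zero_of_notMem_cutRay hz)), mul_comm (Real.log _)]

/-! ### The exponent of convergence -/

/-- The series `∑ |a_n| ^ (-β)` converges for every `β` above the exponent of convergence. -/
lemma summable_rpow_neg_of_convergenceExponent_lt {a : ℕ → ℂ}
    (ha_top : Tendsto (fun n => ‖a n‖) atTop atTop) {α β : ℝ}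
    (hα : convergenceExponent a = (α : EReal)) (hα0 : 0 ≤ α) (hβ : α < β) :
    Summable fun n => ‖a n‖ ^ (-β) := by
  obtain ⟨β', h1, h2⟩ := exists_between hβ
  have hβ' : 0 < β' := hα0.trans_lt h1
  have hev : ∀ᶠ n : ℕ in atTop,
      ((Real.log ((n : ℝ) + 1) / Real.log ‖a n‖ : ℝ) : EReal) < (β' : EReal) := by
    refine eventually_lt_of_limsup_lt ?_
    rw [convergenceExponent] at hα
    rw [hα]
    exact_mod_cast h1
  have hsum : Summable fun n : ℕ => ((n : ℝ) + 1) ^ (-(β / β')) := by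
    have h := (Real.summable_nat_rpow (p := -(β / β'))).2
      (by rw [neg_lt_neg_iff, one_lt_div hβ']; exact h2)
    simpa using (summable_nat_add_iff 1).2 h
  refine hsum.of_norm_bounded_eventually_nat ?_
  filter_upwards [hev, ha_top.eventually_gt_atTop 1] with n hn hn1
  have hlog : 0 < Real.log ‖a n‖ := Real.log_pos hn1
  have hpos : 0 < ‖a n‖ := by linarith
  rw [EReal.coe_lt_coe_iff, div_lt_iff₀ hlog] at hn
  rw [Real.norm_of_nonneg (by positivity), Real.rpow_def_of_pos hpos,
    Real.rpow_def_of_pos (by positivity), Real.exp_le_exp]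
  have : Real.log ((n : ℝ) + 1) * (β / β') ≤ (β' * Real.log ‖a n‖) * (β / β') := by
    have : 0 < β / β' := div_pos (hβ'.trans h2) hβ'
    gcongr
  have h3 : (β' * Real.log ‖a n‖) * (β / β') = Real.log ‖a n‖ * β := by field_simp
  rw [h3] at this
  linarith

/-! ### Elementary factors and the canonical product -/

lemma hasDerivAt_elementaryFactor (q : ℕ) (u : ℂ) :
    HasDerivAt (fun u => elementaryFactor u q)
      (-u ^ q * Complex.exp (∑ j ∈ Finset.Icc 1 q, 1 / (j : ℂ) * u ^ j)) u := by
  have hS : HasDerivAt (fun u : ℂ => ∑ j ∈ Finset.Icc 1 q, 1 / (j : ℂ) * u ^ j)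
      (∑ i ∈ Finset.range q, u ^ i) u := by
    have h : ∀ j ∈ Finset.Icc 1 q,
        HasDerivAt (fun u : ℂ => 1 / (j : ℂ) * u ^ j) (u ^ (j - 1)) u := by
      intro j hj
      have hj0 : (j : ℂ) ≠ 0 := Nat.cast_ne_zero.2 (by have := Finset.mem_Icc.1 hj; omega)
      refine ((hasDerivAt_pow j u).const_mul (1 / (j : ℂ))).congr_deriv ?_
      field_simp
    refine (HasDerivAt.fun_sum h).congr_deriv ?_
    have hIcc : Finset.Icc 1 q = Finset.Ico 1 (q + 1) := by
      ext
      simp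
    rw [hIcc, Finset.sum_Ico_eq_sum_range]
    simp
  have hE := ((hasDerivAt_id u).const_sub 1).mul hS.cexp
  refine HasDerivAt.congr_deriv hE ?_
  have hg := geom_sum_mul_neg u q
  simp only [id]
  linear_combination Complex.exp (∑ j ∈ Finset.Icc 1 q, 1 / (j : ℂ) * u ^ j) * hg

lemma elementaryFactor_zero (q : ℕ) : elementaryFactor 0 q = 1 := by
  have : ∑ j ∈ Finset.Icc 1 q, 1 / (j : ℂ) * (0 : ℂ) ^ j = 0 :=
    Finset.sum_eq_zero fun j hj => by
      rw [zero_pow (by have := Finset.mem_Icc.1 hj; omega), mul_zero]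
  rw [elementaryFactor, this]
  simp

lemma elementaryFactor_ne_zero {u : ℂ} (hu : u ≠ 1) (q : ℕ) : elementaryFactor u q ≠ 0 :=
  mul_ne_zero (sub_ne_zero.2 hu.symm) (Complex.exp_ne_zero _)

/-- The elementary factor `E(u, q)` agrees with `1` to order `q + 1` at the origin, because its
derivative is `-u ^ q` times an exponential. -/
lemma norm_elementaryFactor_sub_one_le (q : ℕ) {u : ℂ} (hu : ‖u‖ ≤ 1) :
    ‖elementaryFactor u q - 1‖ ≤ Real.exp q * ‖u‖ ^ (q + 1) := by
  have hbound : ∀ v ∈ Metric.closedBall (0 : ℂ) ‖u‖,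
      ‖-v ^ q * Complex.exp (∑ j ∈ Finset.Icc 1 q, 1 / (j : ℂ) * v ^ j)‖
        ≤ ‖u‖ ^ q * Real.exp q := by
    intro v hv
    have hv : ‖v‖ ≤ ‖u‖ := by simpa using hv
    rw [norm_mul, norm_neg, norm_pow]
    gcongr
    rw [Complex.norm_exp, Real.exp_le_exp]
    refine (Complex.re_le_norm _).trans ((norm_sum_le _ _).trans ?_)
    calc ∑ j ∈ Finset.Icc 1 q, ‖1 / (j : ℂ) * v ^ j‖
        ≤ ∑ j ∈ Finset.Icc 1 q, (1 : ℝ) := by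
          refine Finset.sum_le_sum fun j hj => ?_
          have hj1 : (1 : ℝ) ≤ j := by exact_mod_cast (Finset.mem_Icc.1 hj).1
          rw [norm_mul, norm_pow, norm_div, norm_one, Complex.norm_natCast]
          have h1 : 1 / (j : ℝ) ≤ 1 := by
            rw [div_le_one (by linarith)]
            exact hj1
          have h2 : ‖v‖ ^ j ≤ 1 := pow_le_one₀ (norm_nonneg _) (hv.trans hu)
          exact mul_le_one₀ h1 (by positivity) h2
      _ = q := by simp
  have h := (convex_closedBall (0 : ℂ) ‖u‖).norm_image_sub_le_of_norm_hasDerivWithin_le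
    (fun v _ => (hasDerivAt_elementaryFactor q v).hasDerivWithinAt) hbound
    (x := 0) (y := u) (by simp) (by simp)
  rw [elementaryFactor_zero, sub_zero] at h
  exact h.trans_eq (by ring)

lemma hasDerivAt_elementaryFactor_div (q : ℕ) (b z : ℂ) :
    HasDerivAt (fun z => elementaryFactor (z / b) q)
      (-(z / b) ^ q * Complex.exp (∑ j ∈ Finset.Icc 1 q, 1 / (j : ℂ) * (z / b) ^ j) * (1 / b)) z :=
  HasDerivAt.comp (h₂ := fun u => elementaryFactor u q) z (hasDerivAt_elementaryFactor q (z / b))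
    ((hasDerivAt_id' z).div_const b)

lemma differentiable_elementaryFactor_div (q : ℕ) (b : ℂ) :
    Differentiable ℂ fun z => elementaryFactor (z / b) q := fun z =>
  (hasDerivAt_elementaryFactor_div q b z).differentiableAt

lemma logDeriv_elementaryFactor_div (q : ℕ) {b z : ℂ} (hb : b ≠ 0) (hz : z ≠ b) :
    logDeriv (fun z => elementaryFactor (z / b) q) z = (z / b) ^ q / (z - b) := by
  rw [logDeriv_apply, (hasDerivAt_elementaryFactor_div q b z).deriv, elementaryFactor]
  have he := Complex.exp_ne_zero (∑ j ∈ Finset.Icc 1 q, 1 / (j : ℂ) * (z / b) ^ j)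
  generalize Complex.exp (∑ j ∈ Finset.Icc 1 q, 1 / (j : ℂ) * (z / b) ^ j) = e at *
  have h1 : z - b ≠ 0 := sub_ne_zero.2 hz
  have h2 : 1 - z / b ≠ 0 := by
    rw [sub_ne_zero]
    intro h
    exact hz ((eq_div_iff hb).1 h ▸ one_mul b)
  rw [div_eq_div_iff (mul_ne_zero h2 he) h1]
  generalize (z / b) ^ q = p
  field_simp
  ring

section CanonicalProduct

variable {a : ℕ → ℂ} {q : ℕ}

lemma eventually_norm_elementaryFactor_sub_one_le
    (ha_top : Tendsto (fun n => ‖a n‖) atTop atTop) (q : ℕ) {R : ℝ} (hR : 0 < R) :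
    ∀ᶠ n in atTop, ∀ z ∈ Metric.ball (0 : ℂ) R,
      ‖elementaryFactor (z / a n) q - 1‖
        ≤ Real.exp q * R ^ (q + 1) * (‖a n‖ ^ (q + 1))⁻¹ := by
  filter_upwards [ha_top.eventually_ge_atTop R] with n hn z hz
  have hz : ‖z‖ < R := by simpa using hz
  have hpos : 0 < ‖a n‖ := hR.trans_le hn
  have hu : ‖z / a n‖ ≤ R / ‖a n‖ := by
    rw [norm_div]
    gcongr
  refine (norm_elementaryFactor_sub_one_le q (hu.trans ((div_le_one hpos).2 hn))).trans ?_
  calc Real.exp q * ‖z / a n‖ ^ (q + 1) ≤ Real.exp q * (R / ‖a n‖) ^ (q + 1) := by gcongr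
    _ = _ := by rw [div_pow]; ring

lemma multipliableLocallyUniformlyOn_elementaryFactor
    (ha_top : Tendsto (fun n => ‖a n‖) atTop atTop)
    (hsum : Summable fun n => (‖a n‖ ^ (q + 1))⁻¹) {R : ℝ} (hR : 0 < R) :
    MultipliableLocallyUniformlyOn (fun n z => elementaryFactor (z / a n) q)
      (Metric.ball (0 : ℂ) R) := by
  have h := Summable.multipliableLocallyUniformlyOn_nat_one_add
    (f := fun n z => elementaryFactor (z / a n) q - 1) (Metric.isOpen_ball (x := (0 : ℂ)) (ε := R))
    (hsum.mul_left _) (eventually_norm_elementaryFactor_sub_one_le ha_top q hR)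
    (fun n => ((differentiable_elementaryFactor_div q (a n)).continuous.sub
      continuous_const).continuousOn)
  simpa using h

lemma summable_norm_elementaryFactor_sub_one
    (ha_top : Tendsto (fun n => ‖a n‖) atTop atTop)
    (hsum : Summable fun n => (‖a n‖ ^ (q + 1))⁻¹) (z : ℂ) :
    Summable fun n => ‖elementaryFactor (z / a n) q - 1‖ := by
  have hR : 0 < ‖z‖ + 1 := by positivity
  refine (hsum.mul_left (Real.exp q * (‖z‖ + 1) ^ (q + 1))).of_norm_bounded_eventually_nat ?_
  filter_upwards [eventually_norm_elementaryFactor_sub_one_le ha_top q hR] with n hn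
  rw [norm_norm]
  exact hn z (by simp)

lemma multipliable_elementaryFactor
    (ha_top : Tendsto (fun n => ‖a n‖) atTop atTop)
    (hsum : Summable fun n => (‖a n‖ ^ (q + 1))⁻¹) (z : ℂ) :
    Multipliable fun n => elementaryFactor (z / a n) q := by
  simpa using multipliable_one_add_of_summable
    (summable_norm_elementaryFactor_sub_one ha_top hsum z)

/-- The logarithmic derivative of the canonical product, provided the series of the logarithmic
derivatives of its factors converges. -/
lemma logDeriv_hadamardFunction
    (ha_top : Tendsto (fun n => ‖a n‖) atTop atTop)
    (hsum : Summable fun n => (‖a n‖ ^ (q + 1))⁻¹) (ha : ∀ n, a n ≠ 0)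
    {z : ℂ} (hz : ∀ n, z ≠ a n) (hm : Summable fun n => (z / a n) ^ q / (z - a n)) :
    logDeriv (hadamardFunction a q) z = ∑' n, (z / a n) ^ q / (z - a n) := by
  have hne : ∀ n, elementaryFactor (z / a n) q ≠ 0 := fun n =>
    elementaryFactor_ne_zero (fun h => hz n ((div_eq_one_iff_eq (ha n)).1 h)) q
  have hfun : (fun n => logDeriv (fun z => elementaryFactor (z / a n) q) z)
      = fun n => (z / a n) ^ q / (z - a n) :=
    funext fun n => logDeriv_elementaryFactor_div q (ha n) (hz n)
  have hR : 0 < ‖z‖ + 1 := by positivity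
  have hprod : ∏' n, elementaryFactor (z / a n) q ≠ 0 := by
    have := tprod_one_add_ne_zero_of_summable
      (f := fun n => elementaryFactor (z / a n) q - 1) (by simpa using hne)
      (summable_norm_elementaryFactor_sub_one ha_top hsum z)
    simpa using this
  have h := logDeriv_tprod_eq_tsum (f := fun n z => elementaryFactor (z / a n) q)
    (Metric.isOpen_ball (x := (0 : ℂ)) (ε := ‖z‖ + 1)) (x := z) (by simp) hne
    (fun n => (differentiable_elementaryFactor_div q (a n)).differentiableOn)
    (by rw [hfun]; exact hm)
    (multipliableLocallyUniformlyOn_elementaryFactor ha_top hsum hR) hprod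
  rw [hfun] at h
  exact h

end CanonicalProduct

/-! ### Primitives in the logarithmic strip -/

/-- The open horizontal strip of height `2π` centred at height `c`; the branches of the logarithm
take their values in such strips. -/
def logStrip (c : ℝ) : Set ℂ :=
  {w | |w.im - c| < Real.pi}

lemma isOpen_logStrip (c : ℝ) : IsOpen (logStrip c) :=
  isOpen_lt (by fun_prop) continuous_const

lemma convex_logStrip (c : ℝ) : Convex ℝ (logStrip c) := by
  have h : logStrip c = Complex.imLm ⁻¹' Metric.ball c Real.pi := by
    ext w
    simp [logStrip, Real.dist_eq]
  rw [h]
  exact (convex_ball c Real.pi).linear_preimage Complex.imLm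

lemma add_ofReal_mem_logStrip {c : ℝ} {w : ℂ} (hw : w ∈ logStrip c) (x : ℝ) :
    w + x ∈ logStrip c := by
  simpa [logStrip] using hw

lemma eq_of_exp_eq_of_mem_logStrip {c : ℝ} {w v : ℂ} (hw : w ∈ logStrip c) (hv : v ∈ logStrip c)
    (h : Complex.exp w = Complex.exp v) : w = v := by
  obtain ⟨n, hn⟩ := Complex.exp_eq_exp_iff_exists_int.1 h
  have him : w.im = v.im + n * (2 * Real.pi) := by
    have := congrArg Complex.im hn
    simpa using this
  have h1 := abs_lt.1 (show |w.im - c| < Real.pi from hw)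
  have h2 := abs_lt.1 (show |v.im - c| < Real.pi from hv)
  have hpi := Real.pi_pos
  have hn0 : n = 0 := by
    have hlt : (n : ℝ) < 1 := by nlinarith
    have hgt : (-1 : ℝ) < n := by nlinarith
    have h3 : n < 1 := by exact_mod_cast hlt
    have h4 : -1 < n := by exact_mod_cast hgt
    omega
  simpa [hn0] using hn

/-- A holomorphic function on the strip that decays like `exp (-ε Re w)` has a primitive with a
limit at the right end of the strip. Two points are compared by moving the left one horizontally
below or above the right one, then vertically. -/
lemma exists_primitive_norm_sub_le {c ε C R : ℝ} (hε : 0 < ε) (hC : 0 ≤ C) {φ : ℂ → ℂ}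
    (hφ : DifferentiableOn ℂ φ (logStrip c))
    (hb : ∀ w ∈ logStrip c, R ≤ w.re → ‖φ w‖ ≤ C * Real.exp (-ε * w.re)) :
    ∃ Φ : ℂ → ℂ, (∀ w ∈ logStrip c, HasDerivAt Φ (φ w) w) ∧
      ∀ w ∈ logStrip c, ∀ v ∈ logStrip c, R ≤ w.re → R ≤ v.re →
        ‖Φ w - Φ v‖
          ≤ (C / ε + C * (2 * Real.pi)) * (Real.exp (-ε * w.re) + Real.exp (-ε * v.re)) := by
  obtain ⟨Φ, hΦ'⟩ := (convex_logStrip c).exists_forall_hasDerivWithinAt hφ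
  have hΦ : ∀ w ∈ logStrip c, HasDerivAt Φ (φ w) w := fun w hw =>
    (hΦ' w hw).hasDerivAt ((isOpen_logStrip c).mem_nhds hw)
  refine ⟨Φ, hΦ, ?_⟩
  have hhor : ∀ w ∈ logStrip c, R ≤ w.re → ∀ x : ℝ, 0 ≤ x →
      ‖Φ (w + x) - Φ w‖ ≤ C / ε * Real.exp (-ε * w.re) := by
    intro w hw hRw x hx
    have hd : ∀ y : ℝ, HasDerivAt (fun y : ℝ => Φ (w + y) - Φ w) (φ (w + y)) y := by
      intro y
      have h1 : HasDerivAt (fun y : ℝ => w + (y : ℂ)) 1 y :=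
        (Complex.ofRealCLM.hasDerivAt (x := y)).const_add w
      have h2 := (hΦ _ (add_ofReal_mem_logStrip hw y)).comp y h1
      simpa using h2.sub_const (Φ w)
    have hB : ∀ y : ℝ, HasDerivAt
        (fun y : ℝ => C / ε * (Real.exp (-ε * w.re) - Real.exp (-ε * (w.re + y))))
        (C * Real.exp (-ε * (w.re + y))) y := by
      intro y
      have h1 : HasDerivAt (fun y : ℝ => -ε * (w.re + y)) (-ε * 1) y :=
        ((hasDerivAt_id' y).const_add w.re).const_mul (-ε)
      refine ((h1.exp.const_sub (Real.exp (-ε * w.re))).const_mul (C / ε)).congr_deriv ?_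
      field_simp
    have hle := image_norm_le_of_norm_deriv_right_le_deriv_boundary (a := 0) (b := x)
      (fun y _ => (hd y).continuousAt.continuousWithinAt)
      (fun y _ => (hd y).hasDerivWithinAt) (by simp) hB
      (fun y hy => by
        have := hb _ (add_ofReal_mem_logStrip hw y) (by simp; linarith [hy.1])
        simpa using this) (Set.right_mem_Icc.2 hx)
    refine hle.trans ?_
    have : 0 ≤ C / ε := by positivity
    have := Real.exp_pos (-ε * (w.re + x))
    gcongr
    linarith
  have hver : ∀ w ∈ logStrip c, ∀ v ∈ logStrip c, R ≤ v.re → w.re = v.re →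
      ‖Φ w - Φ v‖ ≤ C * Real.exp (-ε * v.re) * (2 * Real.pi) := by
    intro w hw v hv hR hre
    have hconv : Convex ℝ (logStrip c ∩ {u | u.re = v.re}) :=
      (convex_logStrip c).inter (convex_hyperplane Complex.reLm.isLinear v.re)
    have h := hconv.norm_image_sub_le_of_norm_hasDerivWithin_le (f := Φ) (f' := φ)
      (C := C * Real.exp (-ε * v.re))
      (fun u hu => (hΦ u hu.1).hasDerivWithinAt)
      (fun u hu => by
        have hu2 : u.re = v.re := hu.2
        have := hb u hu.1 (by rw [hu2]; exact hR)
        rwa [hu2] at this) (x := v) (y := w) ⟨hv, rfl⟩ ⟨hw, hre⟩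
    refine h.trans ?_
    gcongr
    have h1 := abs_lt.1 (show |w.im - c| < Real.pi from hw)
    have h2 := abs_lt.1 (show |v.im - c| < Real.pi from hv)
    refine (Complex.norm_le_abs_re_add_abs_im _).trans ?_
    rw [Complex.sub_re, Complex.sub_im, hre, sub_self, abs_zero, zero_add, abs_le]
    constructor <;> linarith
  have hmain : ∀ w ∈ logStrip c, ∀ v ∈ logStrip c, R ≤ w.re → w.re ≤ v.re →
      ‖Φ w - Φ v‖
        ≤ (C / ε + C * (2 * Real.pi)) * (Real.exp (-ε * w.re) + Real.exp (-ε * v.re)) := by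
    intro w hw v hv hR hle
    have h1 := hhor w hw hR (v.re - w.re) (by linarith)
    have h2 := hver (w + ((v.re - w.re : ℝ) : ℂ)) (add_ofReal_mem_logStrip hw _) v hv
      (hR.trans hle) (by simp)
    have h3 := norm_sub_le_norm_sub_add_norm_sub (Φ w) (Φ (w + ((v.re - w.re : ℝ) : ℂ))) (Φ v)
    rw [norm_sub_rev (Φ w) (Φ (w + _))] at h3
    have h4 : 0 ≤ C / ε * Real.exp (-ε * v.re) := by positivity
    have h5 : 0 ≤ C * (2 * Real.pi) * Real.exp (-ε * w.re) := by
      have := Real.pi_pos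
      positivity
    linarith
  intro w hw v hv hRw hRv
  rcases le_total w.re v.re with h | h
  · exact hmain w hw v hv hRw h
  · rw [norm_sub_rev, add_comm (Real.exp _)]
    exact hmain v hv w hw hRv h

/-! ### Integrals along a contour -/

namespace IsContour

variable {γ : ℝ → ℂ}

lemma exists_countable_hasDerivAt (hγ : IsContour γ) :
    ∃ P : Set ℝ, P.Countable ∧ ∀ t ∉ P, HasDerivAt γ (deriv γ t) t := by
  obtain ⟨P, hP, hd⟩ := hγ.piecewise
  refine ⟨P, ?_, fun t ht => ?_⟩
  · have hU : P = ⋃ n : ℕ, P ∩ Set.Icc (-(n : ℝ)) n := by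
      rw [← Set.inter_iUnion, eq_comm, Set.inter_eq_left]
      intro t _
      obtain ⟨n, hn⟩ := exists_nat_ge |t|
      exact Set.mem_iUnion.2 ⟨n, abs_le.1 hn⟩
    rw [hU]
    exact Set.countable_iUnion fun n => (hP n).countable
  · have h1 : (P ∩ Set.Icc (-(|t| + 1)) (|t| + 1))ᶜ ∈ 𝓝 t :=
      (hP (|t| + 1)).isClosed.isOpen_compl.mem_nhds fun h => ht h.1
    have h2 : Set.Icc (-(|t| + 1)) (|t| + 1) ∈ 𝓝 t :=
      Icc_mem_nhds (by linarith [neg_abs_le t]) (by linarith [le_abs_self t])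
    have h3 : Pᶜ ∈ 𝓝 t := by
      filter_upwards [h1, h2] with x hx1 hx2 hxP using hx1 ⟨hxP, hx2⟩
    exact ((hd.differentiableOn one_ne_zero).differentiableAt h3).hasDerivAt

lemma integrable_mul_deriv (hγ : IsContour γ) {F : ℝ → ℂ} (hF : AEStronglyMeasurable F)
    {C ε : ℝ} (hε : 0 < ε) (hb : ∀ t, ‖F t‖ ≤ C * ‖γ t‖ ^ (-1 - ε)) :
    Integrable fun t => F t * deriv γ t := by
  refine ((hγ.integrable ε hε).const_mul C).mono'
    (hF.mul (measurable_deriv γ).aestronglyMeasurable) (ae_of_all _ fun t => ?_)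
  rw [norm_mul, ← mul_assoc]
  gcongr
  exact hb t

/-- In the coordinate `w = log z`, a holomorphic differential `φ (w) dw` that decays exponentially
at the right end of the strip has integral zero along a contour from `∞` to `∞`: its primitive has
the same limit at both ends. -/
lemma integral_comp_logBranch_eq_zero (hγ : IsContour γ) {Ψ : ℝ} (m : ℤ)
    (hγ_cut : ∀ t, γ t ∉ cutRay Ψ) {ε C R : ℝ} (hε : 0 < ε) (hC : 0 ≤ C) {φ : ℂ → ℂ}
    (hφ : DifferentiableOn ℂ φ (logStrip (Ψ - Real.pi + 2 * Real.pi * m)))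
    (hb : ∀ w ∈ logStrip (Ψ - Real.pi + 2 * Real.pi * m), R ≤ w.re →
      ‖φ w‖ ≤ C * Real.exp (-ε * w.re))
    (hint : Integrable fun t => φ (logBranch Ψ m (γ t)) * ((γ t)⁻¹ * deriv γ t)) :
    ∫ t, φ (logBranch Ψ m (γ t)) * ((γ t)⁻¹ * deriv γ t) = 0 := by
  obtain ⟨Φ, hΦ, hlim⟩ := exists_primitive_norm_sub_le hε hC hφ hb
  obtain ⟨P, hPc, hP⟩ := hγ.exists_countable_hasDerivAt
  set L := fun t => logBranch Ψ m (γ t) with hL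
  have hmem : ∀ t, L t ∈ logStrip (Ψ - Real.pi + 2 * Real.pi * m) := fun t =>
    abs_im_logBranch_sub_lt m (hγ_cut t)
  have hre : ∀ t, (L t).re = Real.log ‖γ t‖ := fun t => re_logBranch m (hγ_cut t)
  have hcont : Continuous fun t => Φ (L t) := by
    refine continuous_iff_continuousAt.2 fun t => ?_
    have h1 : ContinuousAt L t :=
      ContinuousAt.comp (f := γ) (g := logBranch Ψ m)
        (hasDerivAt_logBranch m (hγ_cut t)).continuousAt hγ.continuous.continuousAt
    exact ContinuousAt.comp (f := L) (g := Φ) (hΦ _ (hmem t)).continuousAt h1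
  have hderiv : ∀ t ∉ P, HasDerivAt (fun t => Φ (L t)) (φ (L t) * ((γ t)⁻¹ * deriv γ t)) t := by
    intro t ht
    have h1 : HasDerivAt L ((γ t)⁻¹ * deriv γ t) t :=
      (hasDerivAt_logBranch m (hγ_cut t)).comp t (hP t ht)
    exact (hΦ _ (hmem t)).comp t h1
  have hTop : Tendsto (fun t => (L t).re) atTop atTop := by
    simp only [hre]
    exact Real.tendsto_log_atTop.comp hγ.tendsto_atTop
  have hBot : Tendsto (fun t => (L (-t)).re) atTop atTop := by
    simp only [hre]
    exact Real.tendsto_log_atTop.comp (hγ.tendsto_atBot.comp tendsto_neg_atTop_atBot)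
  have hexp : ∀ {g : ℝ → ℝ}, Tendsto g atTop atTop →
      Tendsto (fun t => Real.exp (-ε * g t)) atTop (𝓝 0) := fun hg =>
    Real.tendsto_exp_atBot.comp (hg.const_mul_atTop_of_neg (neg_lt_zero.2 hε))
  have hzero : Tendsto (fun T => Φ (L T) - Φ (L (-T))) atTop (𝓝 0) := by
    refine squeeze_zero_norm' ?_ (by
      simpa using ((hexp hTop).add (hexp hBot)).const_mul (C / ε + C * (2 * Real.pi)))
    filter_upwards [hTop.eventually_ge_atTop R, hBot.eventually_ge_atTop R] with T h1 h2
    simpa only [neg_mul] using hlim _ (hmem T) _ (hmem (-T)) h1 h2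
  have hFTC : ∀ T, ∫ t in (-T)..T, φ (L t) * ((γ t)⁻¹ * deriv γ t) = Φ (L T) - Φ (L (-T)) :=
    fun T => integral_eq_of_hasDerivAt_off_countable (fun t => Φ (L t)) _ hPc
      hcont.continuousOn (fun t ht => hderiv t ht.2) hint.intervalIntegrable
  have h := intervalIntegral_tendsto_integral hint tendsto_neg_atTop_atBot tendsto_id
  exact tendsto_nhds_unique h (hzero.congr fun T => (hFTC T).symm)

end IsContour

/-! ### Contour integrals of the terms of the logarithmic derivative -/

lemma norm_le_mul_norm_sub {δ : ℝ} (hδ : 0 < δ) {z b : ℂ} (h : δ * ‖b‖ ≤ ‖z - b‖) :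
    ‖z‖ ≤ (1 + 1 / δ) * ‖z - b‖ ∧ ‖b‖ ≤ (1 + 1 / δ) * ‖z - b‖ := by
  have h1 : ‖b‖ ≤ 1 / δ * ‖z - b‖ := by
    rw [one_div, ← div_eq_inv_mul, le_div_iff₀' hδ]
    exact h
  have h2 : ‖z‖ ≤ ‖z - b‖ + ‖b‖ := by simpa using norm_add_le (z - b) b
  have h3 := norm_nonneg (z - b)
  constructor <;> linarith

lemma rpow_mul_rpow_le_mul_norm_sub {δ : ℝ} (hδ : 0 < δ) {z b : ℂ} (h : δ * ‖b‖ ≤ ‖z - b‖)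
    {θ : ℝ} (h0 : 0 ≤ θ) (h1 : θ ≤ 1) :
    ‖z‖ ^ θ * ‖b‖ ^ (1 - θ) ≤ (1 + 1 / δ) * ‖z - b‖ := by
  obtain ⟨hz, hb⟩ := norm_le_mul_norm_sub hδ h
  calc ‖z‖ ^ θ * ‖b‖ ^ (1 - θ)
      ≤ ((1 + 1 / δ) * ‖z - b‖) ^ θ * ((1 + 1 / δ) * ‖z - b‖) ^ (1 - θ) := by
        have : 0 ≤ 1 - θ := by linarith
        gcongr
    _ = (1 + 1 / δ) * ‖z - b‖ := by
        rw [← Real.rpow_add_of_nonneg ((norm_nonneg z).trans hz) h0 (by linarith),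
          add_sub_cancel, Real.rpow_one]

/-- The estimate that separates the variables: the exponent `β` may be chosen anywhere between
`q` and `q + 1`, at the price of trading a power of `‖b‖` against a power of `‖z‖`. -/
lemma norm_powNeg_mul_le {Ψ : ℝ} (m : ℤ) (s : ℂ) {δ : ℝ} (hδ : 0 < δ) {q : ℕ} {β : ℝ}
    (hβ : (q : ℝ) ≤ β) (hβ' : β ≤ q + 1) {z b : ℂ} (hz : z ∉ cutRay Ψ) (hb : b ≠ 0)
    (h : δ * ‖b‖ < ‖z - b‖) :
    ‖powNeg Ψ m s z * ((z / b) ^ q / (z - b))‖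
      ≤ powBound Ψ m s * (1 + 1 / δ) * ‖b‖ ^ (-β) * ‖z‖ ^ (-1 - (s.re - β)) := by
  have hz0 : 0 < ‖z‖ := norm_pos_iff.2 (ne_zero_of_notMem_cutRay hz)
  have hb0 : 0 < ‖b‖ := norm_pos_iff.2 hb
  have hd0 : 0 < ‖z - b‖ := (by positivity : 0 ≤ δ * ‖b‖).trans_lt h
  have hsep := rpow_mul_rpow_le_mul_norm_sub hδ h.le (θ := q + 1 - β) (by linarith) (by linarith)
  have hM : 0 ≤ powBound Ψ m s := (Real.exp_pos _).le
  have hinv : ‖z - b‖⁻¹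
      ≤ (1 + 1 / δ) * (‖z‖ ^ (-((q : ℝ) + 1 - β)) * ‖b‖ ^ (-(1 - ((q : ℝ) + 1 - β)))) := by
    rw [Real.rpow_neg hz0.le, Real.rpow_neg hb0.le, ← mul_inv, ← div_eq_mul_inv,
      le_div_iff₀ (by positivity), inv_mul_le_iff₀ hd0, mul_comm ‖z - b‖]
    exact hsep
  rw [norm_mul, norm_div, norm_pow, norm_div, div_eq_mul_inv (_ ^ q)]
  calc ‖powNeg Ψ m s z‖ * ((‖z‖ / ‖b‖) ^ q * ‖z - b‖⁻¹)
      ≤ (powBound Ψ m s * ‖z‖ ^ (-s.re)) * ((‖z‖ / ‖b‖) ^ q *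
          ((1 + 1 / δ) * (‖z‖ ^ (-((q : ℝ) + 1 - β)) * ‖b‖ ^ (-(1 - ((q : ℝ) + 1 - β)))))) := by
        gcongr
        exact norm_powNeg_le m s hz
    _ = powBound Ψ m s * (1 + 1 / δ)
          * (‖b‖ ^ (-(q : ℝ)) * ‖b‖ ^ (-(1 - ((q : ℝ) + 1 - β))))
          * (‖z‖ ^ (-s.re) * ‖z‖ ^ (q : ℝ) * ‖z‖ ^ (-((q : ℝ) + 1 - β))) := by
        rw [div_pow, Real.rpow_neg hb0.le (q : ℝ), Real.rpow_natCast, Real.rpow_natCast]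
        ring
    _ = _ := by
        rw [← Real.rpow_add hb0, ← Real.rpow_add hz0, ← Real.rpow_add hz0]
        congr 2 <;> ring_nf

/-- The differential `(G w - G v) e ^ w / (e ^ w - e ^ v) + G v` has a removable singularity at
`v`, the only zero of the denominator in the strip, and inherits the decay of `G`. -/
lemma exists_differentiableOn_logStrip {c : ℝ} {G : ℂ → ℂ} (hG : Differentiable ℂ G) {v : ℂ}
    (hv : v ∈ logStrip c) {C ε : ℝ} (hC : 0 ≤ C) (hε1 : ε ≤ 1)
    (hb : ∀ w ∈ logStrip c, 0 ≤ w.re → ‖G w‖ ≤ C * Real.exp (-ε * w.re)) :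
    ∃ φ : ℂ → ℂ, DifferentiableOn ℂ φ (logStrip c) ∧
      (∀ w ∈ logStrip c, w ≠ v → φ w
        = G w * (Complex.exp w / (Complex.exp w - Complex.exp v))
          - G v * (Complex.exp v / (Complex.exp w - Complex.exp v))) ∧
      ∃ C' R : ℝ, 0 ≤ C' ∧
        ∀ w ∈ logStrip c, R ≤ w.re → ‖φ w‖ ≤ C' * Real.exp (-ε * w.re) := by
  have hne : ∀ w ∈ logStrip c, w ≠ v → Complex.exp w - Complex.exp v ≠ 0 := fun w hw hwv h =>
    hwv (eq_of_exp_eq_of_mem_logStrip hw hv (sub_eq_zero.1 h))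
  have hd : ∀ w ∈ logStrip c, dslope Complex.exp v w ≠ 0 := by
    intro w hw
    rcases eq_or_ne w v with rfl | hwv
    · rw [dslope_same, Complex.deriv_exp]
      exact Complex.exp_ne_zero _
    · rw [dslope_of_ne _ hwv, slope_def_field]
      exact div_ne_zero (hne w hw hwv) (sub_ne_zero.2 hwv)
  have hnhds := (isOpen_logStrip c).mem_nhds hv
  have hform : ∀ w ∈ logStrip c, w ≠ v →
      dslope G v w / dslope Complex.exp v w * Complex.exp w + G v
        = G w * (Complex.exp w / (Complex.exp w - Complex.exp v))
          - G v * (Complex.exp v / (Complex.exp w - Complex.exp v)) := by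
    intro w hw hwv
    have h1 := hne w hw hwv
    have h2 := sub_ne_zero.2 hwv
    rw [dslope_of_ne _ hwv, dslope_of_ne _ hwv, slope_def_field, slope_def_field]
    field_simp
    ring
  refine ⟨fun w => dslope G v w / dslope Complex.exp v w * Complex.exp w + G v, ?_, hform,
    2 * C + 2 * (‖G v‖ * ‖Complex.exp v‖), max 0 (v.re + 1), by positivity, ?_⟩
  · exact ((((Complex.differentiableOn_dslope hnhds).2 hG.differentiableOn).div
      ((Complex.differentiableOn_dslope hnhds).2 Complex.differentiable_exp.differentiableOn)
      hd).mul Complex.differentiable_exp.differentiableOn).add_const _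
  -- One unit to the right of `v`, `|e ^ w| ≥ 2 |e ^ v|`, so the denominator is at least half of
  -- `|e ^ w|`.
  · intro w hw hR
    have hw0 : 0 ≤ w.re := (le_max_left _ _).trans hR
    have hw1 : v.re + 1 ≤ w.re := (le_max_right _ _).trans hR
    have hwv : w ≠ v := by
      rintro rfl
      linarith
    have hexp : 2 * ‖Complex.exp v‖ ≤ ‖Complex.exp w‖ := by
      rw [Complex.norm_exp, Complex.norm_exp]
      have h1 : Real.exp (v.re + 1) ≤ Real.exp w.re := Real.exp_le_exp.2 hw1
      rw [Real.exp_add] at h1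
      have h2 := Real.add_one_le_exp (1 : ℝ)
      have h3 := Real.exp_pos v.re
      nlinarith
    have hden : ‖Complex.exp w‖ / 2 ≤ ‖Complex.exp w - Complex.exp v‖ := by
      have := norm_sub_norm_le (Complex.exp w) (Complex.exp v)
      linarith
    have hpos : 0 < ‖Complex.exp w‖ := norm_pos_iff.2 (Complex.exp_ne_zero _)
    have hq1 : ‖Complex.exp w / (Complex.exp w - Complex.exp v)‖ ≤ 2 := by
      rw [norm_div, div_le_iff₀ (by linarith)]
      linarith
    have hq2 : ‖Complex.exp v / (Complex.exp w - Complex.exp v)‖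
        ≤ ‖Complex.exp v‖ * (2 * Real.exp (-ε * w.re)) := by
      rw [norm_div, div_eq_mul_inv]
      gcongr
      calc ‖Complex.exp w - Complex.exp v‖⁻¹ ≤ (‖Complex.exp w‖ / 2)⁻¹ := by gcongr
        _ = 2 * Real.exp (-1 * w.re) := by
            rw [Complex.norm_exp, inv_div, neg_one_mul, Real.exp_neg, div_eq_mul_inv]
        _ ≤ 2 * Real.exp (-ε * w.re) := by gcongr
    show ‖dslope G v w / dslope Complex.exp v w * Complex.exp w + G v‖ ≤ _
    rw [hform w hw hwv]
    calc _ ≤ ‖G w‖ * ‖Complex.exp w / (Complex.exp w - Complex.exp v)‖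
          + ‖G v‖ * ‖Complex.exp v / (Complex.exp w - Complex.exp v)‖ := by
          rw [← norm_mul, ← norm_mul]
          exact norm_sub_le _ _
      _ ≤ (C * Real.exp (-ε * w.re)) * 2
          + ‖G v‖ * (‖Complex.exp v‖ * (2 * Real.exp (-ε * w.re))) := by
          gcongr
          exact hb w hw hw0
      _ = _ := by ring

namespace IsContour

variable {γ : ℝ → ℂ}

lemma continuous_powNeg (hγ : IsContour γ) {Ψ : ℝ} (m : ℤ) (s : ℂ)
    (hγ_cut : ∀ t, γ t ∉ cutRay Ψ) : Continuous fun t => powNeg Ψ m s (γ t) := by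
  have hL : Continuous fun t => logBranch Ψ m (γ t) :=
    continuous_iff_continuousAt.2 fun t =>
      ContinuousAt.comp (f := γ) (g := logBranch Ψ m)
        (hasDerivAt_logBranch m (hγ_cut t)).continuousAt hγ.continuous.continuousAt
  exact Complex.continuous_exp.comp (continuous_const.mul hL)

lemma continuous_powNeg_mul (hγ : IsContour γ) {Ψ : ℝ} (m : ℤ) (s : ℂ)
    (hγ_cut : ∀ t, γ t ∉ cutRay Ψ) (q : ℕ) {b : ℂ} (hb : ∀ t, γ t ≠ b) :
    Continuous fun t => powNeg Ψ m s (γ t) * ((γ t / b) ^ q / (γ t - b)) :=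
  (hγ.continuous_powNeg m s hγ_cut).mul (((hγ.continuous.div_const b).pow q).div
    (hγ.continuous.sub continuous_const) fun t => sub_ne_zero.2 (hb t))

/-- Cauchy's formula for the term of the logarithmic derivative of the canonical product that belongs
to the zero `b`.
With `g (z) = z ^ (-s) (z / b) ^ q`, the differential `g (z) dz / (z - b)` is `g (b)` times
`dz / (z - b) - dz / z`, which integrates to the index, plus a differential that is holomorphic off
the cut and decays at infinity. -/
lemma integral_powNeg_mul (hγ : IsContour γ) {Ψ : ℝ} (m : ℤ) {s : ℂ}
    (hγ_cut : ∀ t, γ t ∉ cutRay Ψ) {q : ℕ} (hs : (q : ℝ) < s.re) {δ : ℝ} (hδ : 0 < δ) {b : ℂ}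
    (hb_cut : b ∉ cutRay Ψ) (hb : ∀ t, δ * ‖b‖ < ‖γ t - b‖) (hind : contourIndex γ b = 1) :
    Integrable (fun t => powNeg Ψ m s (γ t) * ((γ t / b) ^ q / (γ t - b)) * deriv γ t) ∧
    ∫ t, powNeg Ψ m s (γ t) * ((γ t / b) ^ q / (γ t - b)) * deriv γ t
      = 2 * (Real.pi : ℂ) * Complex.I * powNeg Ψ m s b := by
  have hb0 : b ≠ 0 := ne_zero_of_notMem_cutRay hb_cut
  have hγ0 : ∀ t, γ t ≠ 0 := fun t => ne_zero_of_notMem_cutRay (hγ_cut t)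
  have hγb : ∀ t, γ t ≠ b := fun t h => by
    have := hb t
    rw [h, sub_self, norm_zero] at this
    have : 0 ≤ δ * ‖b‖ := by positivity
    linarith
  have hInt1 : Integrable
      fun t => powNeg Ψ m s (γ t) * ((γ t / b) ^ q / (γ t - b)) * deriv γ t :=
    hγ.integrable_mul_deriv (hγ.continuous_powNeg_mul m s hγ_cut q hγb).aestronglyMeasurable
      (sub_pos.2 hs) fun t => norm_powNeg_mul_le m s hδ le_rfl (by linarith) (hγ_cut t) hb0 (hb t)
  have hInt2 : Integrable fun t => (1 / (γ t - b) - 1 / γ t) * deriv γ t := by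
    refine hγ.integrable_mul_deriv (ε := 1) (C := ‖b‖ * (1 + 1 / δ)) ?_ one_pos fun t => ?_
    · exact ((continuous_const.div (hγ.continuous.sub continuous_const)
        fun t => sub_ne_zero.2 (hγb t)).sub
        (continuous_const.div hγ.continuous hγ0)).aestronglyMeasurable
    · have h1 : 1 / (γ t - b) - 1 / γ t = b / (γ t * (γ t - b)) := by
        have := sub_ne_zero.2 (hγb t)
        have := hγ0 t
        field_simp
        ring
      have hz0 : 0 < ‖γ t‖ := norm_pos_iff.2 (hγ0 t)
      have hd0 : 0 < ‖γ t - b‖ := norm_pos_iff.2 (sub_ne_zero.2 (hγb t))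
      have hle := (norm_le_mul_norm_sub hδ (hb t).le).1
      have h2 : ‖γ t‖ ^ (-1 - 1 : ℝ) = ‖γ t‖⁻¹ * ‖γ t‖⁻¹ := by
        rw [sub_eq_add_neg, Real.rpow_add hz0, Real.rpow_neg_one]
      have h3 : ‖γ t - b‖⁻¹ ≤ (1 + 1 / δ) * ‖γ t‖⁻¹ := by
        rw [← div_eq_mul_inv, le_div_iff₀ hz0, inv_mul_le_iff₀ hd0, mul_comm ‖γ t - b‖]
        exact hle
      rw [h1, h2, norm_div, norm_mul, div_eq_mul_inv, mul_inv]
      calc ‖b‖ * (‖γ t‖⁻¹ * ‖γ t - b‖⁻¹) ≤ ‖b‖ * (‖γ t‖⁻¹ * ((1 + 1 / δ) * ‖γ t‖⁻¹)) := by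
            gcongr
        _ = _ := by ring
  refine ⟨hInt1, ?_⟩
  set G : ℂ → ℂ := fun w => Complex.exp (-s * w) * (Complex.exp w / b) ^ q with hG
  have hGL : ∀ z ∉ cutRay Ψ, G (logBranch Ψ m z) = powNeg Ψ m s z * (z / b) ^ q := by
    intro z hz
    simp only [hG, exp_logBranch m hz, powNeg]
  have hGb : G (logBranch Ψ m b) = powNeg Ψ m s b := by
    rw [hGL b hb_cut, div_self hb0, one_pow, mul_one]
  have hGdiff : Differentiable ℂ G := by
    have h1 : Differentiable ℂ fun w : ℂ => Complex.exp (-s * w) :=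
      (differentiable_id.const_mul (-s)).cexp
    exact h1.mul ((Complex.differentiable_exp.div_const b).pow q)
  set ε := min (s.re - q) 1 with hε
  have hGbound : ∀ w ∈ logStrip (Ψ - Real.pi + 2 * Real.pi * m), 0 ≤ w.re →
      ‖G w‖ ≤ powBound Ψ m s * (‖b‖ ^ q)⁻¹ * Real.exp (-ε * w.re) := by
    intro w hw hw0
    have hM : 0 ≤ powBound Ψ m s := (Real.exp_pos _).le
    simp only [hG, norm_mul, norm_pow, norm_div]
    calc ‖Complex.exp (-s * w)‖ * (‖Complex.exp w‖ / ‖b‖) ^ q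
        ≤ (powBound Ψ m s * Real.exp (-s.re * w.re)) * (‖Complex.exp w‖ / ‖b‖) ^ q := by
          gcongr
          exact norm_exp_neg_mul_le s hw
      _ = powBound Ψ m s * (‖b‖ ^ q)⁻¹ * Real.exp (-(s.re - q) * w.re) := by
          have : Real.exp (-(s.re - q) * w.re) = Real.exp (-s.re * w.re) * Real.exp w.re ^ q := by
            rw [← Real.exp_nat_mul, ← Real.exp_add]
            ring_nf
          rw [this, Complex.norm_exp, div_pow]
          ring
      _ ≤ _ := by
          gcongr
          exact min_le_left _ _
  obtain ⟨φ, hφ, hform, C', R, hC', hb'⟩ := exists_differentiableOn_logStrip hGdiff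
    (abs_im_logBranch_sub_lt m hb_cut) (by rw [powBound]; positivity) (min_le_right _ _) hGbound
  have hpt : (fun t => φ (logBranch Ψ m (γ t)) * ((γ t)⁻¹ * deriv γ t))
      = fun t => powNeg Ψ m s (γ t) * ((γ t / b) ^ q / (γ t - b)) * deriv γ t
        - powNeg Ψ m s b * ((1 / (γ t - b) - 1 / γ t) * deriv γ t) := by
    ext t
    have hne : logBranch Ψ m (γ t) ≠ logBranch Ψ m b := fun h => hγb t (by
      rw [← exp_logBranch m (hγ_cut t), h, exp_logBranch m hb_cut])
    rw [hform _ (abs_im_logBranch_sub_lt m (hγ_cut t)) hne, hGL _ (hγ_cut t), hGb,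
      exp_logBranch m (hγ_cut t), exp_logBranch m hb_cut]
    have := sub_ne_zero.2 (hγb t)
    have := hγ0 t
    generalize (γ t / b) ^ q = p
    field_simp
    ring
  have hzero := hγ.integral_comp_logBranch_eq_zero m hγ_cut
    (lt_min (sub_pos.2 hs) one_pos) hC' hφ hb'
    (by rw [hpt]; exact hInt1.sub (hInt2.const_mul _))
  rw [hpt, integral_sub hInt1 (hInt2.const_mul _), integral_const_mul, sub_eq_zero] at hzero
  have hpi : 2 * (Real.pi : ℂ) * Complex.I ≠ 0 := Complex.two_pi_I_ne_zero
  rw [contourIndex, inv_mul_eq_one₀ hpi] at hind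
  rw [hzero, ← hind, mul_comm]

end IsContour

end ZetaContour

/-! ### The contour integral of the logarithmic derivative -/

open ZetaContour in
theorem mainTheorem1 (a : ℕ → ℂ)
    (ha_pos : 0 < ‖a 0‖) (ha_mono : Monotone fun n => ‖a n‖)
    (ha_top : Tendsto (fun n => ‖a n‖) atTop atTop)
    (α : ℝ) (hα : ZetaContour.convergenceExponent a = (α : EReal))
    (Ψ : ℝ) (hΨ : Ψ ∈ Set.Ico (-Real.pi) Real.pi)
    (ha_cut : ∀ n, a n ∉ ZetaContour.cutRay Ψ)
    (m : ℤ)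
    (k : ℕ) (hk : 1 ≤ k) (hkα : (k : ℝ) - 1 ≤ α) (hαk : α < k)
    (δ : ℝ) (hδ : 0 < δ)
    (γ : ℝ → ℂ) (hγ : ZetaContour.IsContour γ)
    (hγ_disc : ∀ t, γ t ∉ ZetaContour.discUnion a δ)
    (hγ_cut : ∀ t, γ t ∉ ZetaContour.cutRay Ψ)
    (hγ_encl : ∀ n, ZetaContour.contourIndex γ (a n) = 1)
    (s : ℂ) (hs : α < s.re) :
    (∀ z : ℂ, Multipliable fun n => ZetaContour.elementaryFactor (z / a n) (k - 1)) ∧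
    Summable (fun n => ‖ZetaContour.powNeg Ψ m s (a n)‖) ∧
    Integrable (fun t => ZetaContour.powNeg Ψ m s (γ t)
      * logDeriv (ZetaContour.hadamardFunction a (k - 1)) (γ t) * deriv γ t) ∧
    ZetaContour.zetaSeq Ψ m a s =
      1 / (2 * (Real.pi : ℂ) * Complex.I) *
        ∫ t, ZetaContour.powNeg Ψ m s (γ t)
          * logDeriv (ZetaContour.hadamardFunction a (k - 1)) (γ t) * deriv γ t := by
  obtain ⟨q, rfl⟩ : ∃ q, k = q + 1 := ⟨k - 1, by omega⟩
  rw [Nat.add_sub_cancel]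
  push_cast at hkα hαk
  rw [add_sub_cancel_right] at hkα
  have hα0 : 0 ≤ α := (Nat.cast_nonneg q).trans hkα
  have ha : ∀ n, a n ≠ 0 := fun n => norm_pos_iff.1 (ha_pos.trans_le (ha_mono (Nat.zero_le n)))
  have hdisc : ∀ n t, δ * ‖a n‖ < ‖γ t - a n‖ := fun n t => by
    rw [norm_sub_rev]
    exact not_le.1 fun h => hγ_disc t (Set.mem_iUnion.2 ⟨n, h⟩)
  have hγa : ∀ n t, γ t ≠ a n := fun n t h => by
    have h1 := hdisc n t
    rw [h, sub_self, norm_zero] at h1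
    have : 0 ≤ δ * ‖a n‖ := by positivity
    linarith
  have hsumk : Summable fun n => (‖a n‖ ^ (q + 1))⁻¹ := by
    have h := summable_rpow_neg_of_convergenceExponent_lt ha_top hα hα0 hαk
    refine h.congr fun n => ?_
    rw [Real.rpow_neg (norm_nonneg _), ← Nat.cast_succ, Real.rpow_natCast]
  -- An exponent strictly between `α` and `min (re s) k` makes both the sum over `n` and the
  -- integral over the contour of the separated bound converge.
  obtain ⟨β, hαβ, hβ⟩ := exists_between (lt_min hs hαk)
  have hβs : β < s.re := hβ.trans_le (min_le_left _ _)
  have hβk : β < q + 1 := hβ.trans_le (min_le_right _ _)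
  have hsumβ := summable_rpow_neg_of_convergenceExponent_lt ha_top hα hα0 hαβ
  have hterm : ∀ n t, ‖powNeg Ψ m s (γ t) * ((γ t / a n) ^ q / (γ t - a n))‖
      ≤ powBound Ψ m s * (1 + 1 / δ) * ‖a n‖ ^ (-β) * ‖γ t‖ ^ (-1 - (s.re - β)) := fun n t =>
    norm_powNeg_mul_le m s hδ (hkα.trans hαβ.le) hβk.le (hγ_cut t) (ha n) (hdisc n t)
  have hsum : ∀ t, Summable fun n => (γ t / a n) ^ q / (γ t - a n) := fun t => by
    have h : Summable fun n => powNeg Ψ m s (γ t) * ((γ t / a n) ^ q / (γ t - a n)) :=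
      .of_norm_bounded ((hsumβ.mul_left _).mul_right _) fun n => hterm n t
    exact (summable_mul_left_iff (Complex.exp_ne_zero _)).1 h
  have hHasSum : ∀ t, HasSum
      (fun n => powNeg Ψ m s (γ t) * ((γ t / a n) ^ q / (γ t - a n)) * deriv γ t)
      (powNeg Ψ m s (γ t) * logDeriv (hadamardFunction a q) (γ t) * deriv γ t) := fun t => by
    rw [logDeriv_hadamardFunction ha_top hsumk ha (fun n => hγa n t) (hsum t)]
    exact ((hsum t).hasSum.mul_left _).mul_right _
  have hCauchy := fun n => hγ.integral_powNeg_mul m hγ_cut (hkα.trans_lt hs) hδ (ha_cut n)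
    (hdisc n) (hγ_encl n)
  have hbound : ∀ n t, ‖powNeg Ψ m s (γ t) * ((γ t / a n) ^ q / (γ t - a n)) * deriv γ t‖
      ≤ ‖a n‖ ^ (-β) * (powBound Ψ m s * (1 + 1 / δ)
        * (‖γ t‖ ^ (-1 - (s.re - β)) * ‖deriv γ t‖)) := fun n t => by
    rw [norm_mul]
    refine (mul_le_mul_of_nonneg_right (hterm n t) (norm_nonneg _)).trans_eq ?_
    ring
  have hdom := (hγ.integrable (s.re - β) (sub_pos.2 hβs)).const_mul
    (powBound Ψ m s * (1 + 1 / δ))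
  have hdomsum : Integrable fun t => ∑' n, ‖a n‖ ^ (-β) * (powBound Ψ m s * (1 + 1 / δ)
      * (‖γ t‖ ^ (-1 - (s.re - β)) * ‖deriv γ t‖)) := by
    simp only [tsum_mul_right]
    exact hdom.const_mul _
  have hmain := hasSum_integral_of_dominated_convergence _ (fun n => (hCauchy n).1.1)
    (fun n => ae_of_all _ (hbound n)) (ae_of_all _ fun t => hsumβ.mul_right _) hdomsum
    (ae_of_all _ hHasSum)
  refine ⟨multipliable_elementaryFactor ha_top hsumk, ?_, ?_, ?_⟩
  · refine ((summable_rpow_neg_of_convergenceExponent_lt ha_top hα hα0 hs).mul_left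
      (powBound Ψ m s)).of_nonneg_of_le (fun n => norm_nonneg _) fun n => ?_
    exact norm_powNeg_le m s (ha_cut n)
  · refine hdomsum.mono' ?_ (ae_of_all _ fun t => ?_)
    · exact aestronglyMeasurable_of_tendsto_ae atTop
        (fun n => (integrable_finsetSum (Finset.range n) fun i _ => (hCauchy i).1).1)
        (ae_of_all _ fun t => (hHasSum t).tendsto_sum_nat)
    · rw [← (hHasSum t).tsum_eq]
      exact tsum_of_norm_bounded (hsumβ.mul_right _).hasSum fun n => hbound n t
  · have hpi : 2 * (Real.pi : ℂ) * Complex.I ≠ 0 := Complex.two_pi_I_ne_zero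
    rw [← hmain.tsum_eq]
    simp only [fun n => (hCauchy n).2]
    rw [tsum_mul_left, zetaSeq, ← mul_assoc, one_div, inv_mul_cancel₀ hpi, one_mul]
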